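/- Let $\mathcal M=(\mathcal S,\Sigma,\mathcal A,\tau_a,R,\gamma)$ and $\overline{\mathcal M}=(\overline{\mathcal S},\overline\Sigma,\overline{\mathcal A},\overline\tau_{\overline a},\overline R,\overline\gamma)$ be continuous Markov decision processes: $(\mathcal S,\Sigma)$ is a measurable space of states, $\mathcal A$ is a space of actions with its Borel $\sigma$-algebra, $\tau_a$ is for each $a\in\mathcal A$ a Markov kernel from $(\mathcal S,\Sigma)$ to itself, $R:\mathcal S\times\mathcal A\to\mathbb R$ is a reward function and $\gamma\in(0,1]$ is a discount factor, and likewise for $\overline{\mathcal M}$. Assume that the action spaces $\mathcal A$ and $\overline{\mathcal A}$ are separable locally compact metric spaces. Let $h=(f,(g_s)_{s\in\mathcal S})$ be a continuous MDP homomorphism from $\mathcal M$ onto $\overline{\mathcal M}$, that is, $f:\mathcal S\to\overline{\mathcal S}$ and, for every $s\in\mathcal S$, $g_s:\mathcal A\to\overline{\mathcal A}$ are measurable surjective maps such that, for all $s\in\mathcal S$ and $a\in\mathcal A$, $$\overline R(f(s),g_s(a))=R(s,a)\quad\text{and}\quad \overline\tau_{g_s(a)}(\overline B\mid f(s))=\tau_a(f^{-1}(\overline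 B)\mid s)\quad\text{for all }\overline B\in\overline\Sigma .$$ A policy on an MDP is a map that assigns to each state a Borel probability measure on the action space. Then for every policy $\overline\pi$ on $\overline{\mathcal M}$ there is a lifted policy, that is, a policy $\pi^\uparrow$ on $\mathcal M$ such that $$\pi^\uparrow(g_s^{-1}(\beta)\mid s)=\overline\pi(\beta\mid f(s))\qquad\text{for every } s\in\mathcal S \text{ and every Borel set }\beta\subseteq\overline{\mathcal A};$$ in other words, $\overline\pi(\cdot\mid f(s))$ is the pushforward of $\pi^\uparrow(\cdot\mid s)$ under $g_s$ for every $s\in\mathcal S$. -/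

import Mathlib

open MeasureTheory ProbabilityTheory TopologicalSpace

/-- A continuous Markov decision process with state space `S` (with its σ-algebra) and action
space `A`: a Markov kernel on `S` for each action, a reward function and a discount factor. -/
structure ContinuousMDP (S A : Type*) [MeasurableSpace S] where
  /-- the transition probability kernel of each action; `τ a s` is `τ_a(· | s)` -/
  τ : A → Kernel S S
  markov : ∀ a, IsMarkovKernel (τ a)
  /-- the reward function -/
  R : S → A → ℝ
  /-- the discount factor -/
  γ : ℝ
  γ_pos : 0 < γ
  γ_le_one : γ ≤ 1

/-- A policy on an MDP assigns to each state a probability measure on the actions. -/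
abbrev ContinuousMDP.Policy {S A : Type*} [MeasurableSpace S] [MeasurableSpace A]
    (_M : ContinuousMDP S A) : Type _ :=
  S → ProbabilityMeasure A

/-- A continuous MDP homomorphism `h = (f, g_s)` from `M` onto its image `M'`: measurable
surjections `f` of the states and, for each state `s`, `g s` of the actions, which leave the reward
invariant and under which the transitions are equivariant. -/
structure ContinuousMDPHom {S A S' A' : Type*} [MeasurableSpace S] [MeasurableSpace A]
    [MeasurableSpace S'] [MeasurableSpace A']
    (M : ContinuousMDP S A) (M' : ContinuousMDP S' A') where
  /-- the state map -/
  f : S → S'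
  /-- the state-dependent action maps -/
  g : S → A → A'
  measurable_f : Measurable f
  surjective_f : Function.Surjective f
  measurable_g : ∀ s, Measurable (g s)
  surjective_g : ∀ s, Function.Surjective (g s)
  reward_invariant : ∀ s a, M'.R (f s) (g s a) = M.R s a
  transition_equivariant : ∀ s a (B : Set S'), MeasurableSet B →
    M'.τ (g s a) (f s) B = M.τ a s (f ⁻¹' B)

/-- `π` is a lifted policy of `πbar` along `h`: for every state `s`, the measure `πbar (f s)` is
the pushforward of `π s` under `g s`. -/
def ContinuousMDPHom.IsLiftedPolicy {S A S' A' : Type*} [MeasurableSpace S] [MeasurableSpace A]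
    [MeasurableSpace S'] [MeasurableSpace A']
    {M : ContinuousMDP S A} {M' : ContinuousMDP S' A'} (h : ContinuousMDPHom M M')
    (πbar : M'.Policy) (π : M.Policy) : Prop :=
  ∀ s (β : Set A'), MeasurableSet β →
    (π s : Measure A) (h.g s ⁻¹' β) = (πbar (h.f s) : Measure A') β

/-! A policy need not be measurable in the state, so each state is treated separately: a probability
measure on the target must be lifted along a Borel surjection `g`. It suffices to push it forward
along a measurable right inverse of `g` defined almost everywhere. The action space is σ-compact,
hence a continuous image of the Baire space, which reduces the search to sections from there. Images
of cylinders may fail to be Borel, so they are replaced by measurable hulls, and a branch of hulls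
containing the point is followed by always taking the least admissible index. -/

/-- A sequence whose terms are computed measurably from the preceding ones depends measurably on
the parameter. -/
theorem exists_measurable_seq_of_res {Y : Type*} [MeasurableSpace Y] {c : List ℕ → Y → ℕ}
    (hc : ∀ σ, Measurable (c σ)) :
    ∃ s : Y → (ℕ → ℕ), Measurable s ∧ ∀ y n, s y n = c (PiNat.res (s y) n) y := by
  let p : ℕ → Y → List ℕ := fun n y => Nat.rec [] (fun _ σ => c σ y :: σ) n
  -- `List ℕ` is countable, so with the discrete σ-algebra joint measurability reduces to that of
  -- each `c σ`.
  let : MeasurableSpace (List ℕ) := ⊤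
  have hcp : ∀ n, Measurable (p n) → Measurable fun y => c (p n y) y := fun n hn =>
    (measurable_from_prod_countable_right (f := fun q : List ℕ × Y => c q.1 q.2) hc).comp
      (hn.prodMk measurable_id)
  have hp : ∀ n, Measurable (p n) := by
    intro n
    induction n with
    | zero => exact measurable_const
    | succ n ih =>
      exact (measurable_from_prod_countable_right (f := fun q : ℕ × List ℕ => q.1 :: q.2)
        fun _ => measurable_from_top).comp ((hcp n ih).prodMk ih)
  have hres : ∀ y n, PiNat.res (fun n => c (p n y) y) n = p n y := by
    intro y n
    induction n with
    | zero => rfl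
    | succ n ih => rw [PiNat.res_succ, ih]
  exact ⟨fun y n => c (p n y) y, measurable_pi_lambda _ fun n => hcp n (hp n),
    fun y n => by rw [hres]⟩

open Set in
/-- A continuous surjection from the Baire space onto a regular Hausdorff space
admits a Borel measurable section almost everywhere, for every s-finite measure. -/
theorem Continuous.exists_measurable_ae_section {Y : Type*} [TopologicalSpace Y] [T3Space Y]
    [MeasurableSpace Y] [OpensMeasurableSpace Y] {g : (ℕ → ℕ) → Y} (hg : Continuous g)
    (hsurj : Function.Surjective g) (ν : Measure Y) [SFinite ν] :
    ∃ s : Y → (ℕ → ℕ), Measurable s ∧ ∀ᵐ y ∂ν, g (s y) = y := by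
  classical
  -- images of cylinders, indexed by reversed finite prefixes, and measurable hulls of them
  let A : List ℕ → Set Y := fun σ => g '' {x | PiNat.res x σ.length = σ}
  let H : List ℕ → Set Y := fun σ => toMeasurable ν (A σ) ∩ closure (A σ)
  have hH : ∀ σ, MeasurableSet (H σ) := fun σ =>
    (measurableSet_toMeasurable _ _).inter isClosed_closure.measurableSet
  have hAH : ∀ σ, A σ ⊆ H σ := fun σ => subset_inter (subset_toMeasurable _ _) subset_closure
  have hA : ∀ σ, A σ ⊆ ⋃ k, A (k :: σ) := by
    rintro σ _ ⟨x, hx, rfl⟩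
    refine mem_iUnion.2 ⟨x σ.length, x, ?_, rfl⟩
    simpa using hx
  -- Against a measurable set, a hull of `A σ` has the same measure as `A σ`, and `A σ` lies inside
  -- the union of the child hulls.
  have hnull : ∀ σ, ν (H σ \ ⋃ k, H (k :: σ)) = 0 := by
    intro σ
    have hU : MeasurableSet (⋃ k, H (k :: σ)) := MeasurableSet.iUnion fun k => hH _
    refine measure_mono_null (sdiff_subset_sdiff_left inter_subset_left) ?_
    rw [sdiff_eq, Measure.measure_toMeasurable_inter_of_sFinite hU.compl, ← sdiff_eq,
      sdiff_eq_empty.2 ((hA σ).trans (iUnion_mono fun k => hAH _)), measure_empty]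
  -- The second alternative makes the search total; there the index defaults to 0.
  have hfind : ∀ σ y, ∃ k, y ∈ H (k :: σ) ∨ y ∉ ⋃ j, H (j :: σ) := by
    intro σ y
    by_cases hy : y ∈ ⋃ j, H (j :: σ)
    · obtain ⟨k, hk⟩ := mem_iUnion.1 hy
      exact ⟨k, Or.inl hk⟩
    · exact ⟨0, Or.inr hy⟩
  let pick : List ℕ → Y → ℕ := fun σ y => Nat.find (hfind σ y)
  have hpick : ∀ σ, Measurable (pick σ) := fun σ =>
    measurable_find _ fun k => (hH _).union (MeasurableSet.iUnion fun j => hH _).compl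
  obtain ⟨s, hs, hsp⟩ := exists_measurable_seq_of_res hpick
  refine ⟨s, hs, ?_⟩
  have hae : ∀ᵐ y ∂ν, ∀ σ, y ∉ H σ \ ⋃ k, H (k :: σ) :=
    ae_all_iff.2 fun σ => measure_eq_zero_iff_ae_notMem.1 (hnull σ)
  filter_upwards [hae] with y hy
  have hmem : ∀ n, y ∈ H (PiNat.res (s y) n) := by
    intro n
    induction n with
    | zero =>
      obtain ⟨x, rfl⟩ := hsurj y
      exact hAH _ ⟨x, rfl, rfl⟩
    | succ n ih =>
      have h1 : y ∈ ⋃ k, H (k :: PiNat.res (s y) n) := by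
        by_contra h
        exact hy _ ⟨ih, h⟩
      rw [PiNat.res_succ, hsp]
      exact (Nat.find_spec (hfind (PiNat.res (s y) n) y)).resolve_right (not_not.2 h1)
  -- The closures in `H` enter here: by continuity and regularity, a short enough prefix cylinder
  -- around `s y` has image in a closed set avoiding `y`.
  by_contra hne
  obtain ⟨V, ⟨hV, hVc⟩, hyV⟩ := (closed_nhds_basis (g (s y))).mem_iff.1
    (isOpen_compl_singleton.mem_nhds (show g (s y) ∈ ({y} : Set Y)ᶜ from hne))
  obtain ⟨_, ⟨x, n, rfl⟩, hx, hsub⟩ :=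
    (PiNat.isTopologicalBasis_cylinders fun _ => ℕ).mem_nhds_iff.1 (hg.continuousAt hV)
  have hcl : closure (A (PiNat.res (s y) n)) ⊆ V := by
    refine closure_minimal ?_ hVc
    rintro _ ⟨z, hz, rfl⟩
    refine hsub ?_
    rw [mem_ofPred_eq, PiNat.res_length, PiNat.res_eq_res] at hz
    intro i hi
    rw [hz hi]
    exact hx i hi
  exact hyV (hcl (hmem n).2) rfl

/-- A measurable surjection from a standard Borel space admits a measurable section almost
everywhere, for every s-finite measure on the target. -/
theorem Measurable.exists_measurable_ae_section {X Y : Type*} [MeasurableSpace X]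
    [StandardBorelSpace X] [TopologicalSpace Y] [T3Space Y] [SecondCountableTopology Y]
    [MeasurableSpace Y] [OpensMeasurableSpace Y] {g : X → Y} (hg : Measurable g)
    (hsurj : Function.Surjective g) [Nonempty Y] (ν : Measure Y) [SFinite ν] :
    ∃ s : Y → X, Measurable s ∧ ∀ᵐ y ∂ν, g (s y) = y := by
  have : Nonempty X := hsurj.nonempty
  let := upgradeStandardBorel X
  obtain ⟨φ, hφ, hgφ, hφs⟩ :
      ∃ φ : (ℕ → ℕ) → X, Continuous φ ∧ Continuous (g ∘ φ) ∧ Function.Surjective φ := by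
    -- A finer Polish topology makes `g` continuous; maps continuous into it remain continuous into
    -- the original one.
    obtain ⟨t, ht, hgt, hpol⟩ := hg.exists_continuous
    obtain ⟨φ, hφ, hφs⟩ := @PolishSpace.exists_nat_nat_continuous_surjective X t hpol _
    exact ⟨φ, continuous_le_rng ht hφ, @Continuous.comp _ _ _ _ t _ _ _ hgt hφ, hφs⟩
  obtain ⟨s, hs, hae⟩ := hgφ.exists_measurable_ae_section (hsurj.comp hφs) ν
  exact ⟨φ ∘ s, hφ.measurable.comp hs, hae⟩

/-- A nonempty `σ`-compact metrizable space is a continuous image of the Baire space. -/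
theorem exists_nat_nat_continuous_surjective_of_sigmaCompact (X : Type*) [TopologicalSpace X]
    [MetrizableSpace X] [SigmaCompactSpace X] [Nonempty X] :
    ∃ φ : (ℕ → ℕ) → X, Continuous φ ∧ Function.Surjective φ := by
  let := metrizableSpaceMetric X
  have : ∀ n, CompactSpace (compactCovering X n) := fun n =>
    isCompact_iff_compactSpace.1 (isCompact_compactCovering X n)
  let F : (Σ n, compactCovering X n) → X := fun q => q.2
  have hF : Continuous F := continuous_sigma fun n => continuous_subtype_val
  have hFs : Function.Surjective F := fun x =>
    ⟨⟨_, x, (exists_mem_compactCovering x).choose_spec⟩, rfl⟩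
  have : Nonempty (Σ n, compactCovering X n) := hFs.nonempty
  obtain ⟨φ, hφ, hφs⟩ := PolishSpace.exists_nat_nat_continuous_surjective (Σ n, compactCovering X n)
  exact ⟨F ∘ φ, hF.comp hφ, hFs.comp hφs⟩

/-- Along a measurable surjection from a `σ`-compact metrizable space, every probability measure
is a pushforward. -/
theorem MeasureTheory.ProbabilityMeasure.exists_map_eq_of_surjective {X Y : Type*}
    [TopologicalSpace X] [MetrizableSpace X] [SigmaCompactSpace X] [MeasurableSpace X]
    [BorelSpace X] [TopologicalSpace Y] [T3Space Y] [SecondCountableTopology Y] [MeasurableSpace Y]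
    [OpensMeasurableSpace Y] {g : X → Y} (hg : Measurable g) (hsurj : Function.Surjective g)
    (ν : ProbabilityMeasure Y) :
    ∃ μ : ProbabilityMeasure X, (μ : Measure X).map g = ν := by
  have : Nonempty Y := (ν : Measure Y).nonempty_of_neZero
  have : Nonempty X := hsurj.nonempty
  obtain ⟨φ, hφ, hφs⟩ := exists_nat_nat_continuous_surjective_of_sigmaCompact X
  obtain ⟨s, hs, hae⟩ :=
    (hg.comp hφ.measurable).exists_measurable_ae_section (hsurj.comp hφs) (ν : Measure Y)
  have hm : Measurable (φ ∘ s) := hφ.measurable.comp hs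
  refine ⟨⟨(ν : Measure Y).map (φ ∘ s), Measure.isProbabilityMeasure_map hm.aemeasurable⟩, ?_⟩
  change ((ν : Measure Y).map (φ ∘ s)).map g = ν
  rw [Measure.map_map hg hm]
  exact (Measure.map_congr hae).trans Measure.map_id

theorem mainTheorem3 {S A S' A' : Type*}
    [MeasurableSpace S] [MeasurableSpace S']
    [MetricSpace A] [LocallyCompactSpace A] [SeparableSpace A] [MeasurableSpace A] [BorelSpace A]
    [MetricSpace A'] [LocallyCompactSpace A'] [SeparableSpace A'] [MeasurableSpace A']
    [BorelSpace A']
    (M : ContinuousMDP S A) (M' : ContinuousMDP S' A') (h : ContinuousMDPHom M M')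
    (πbar : M'.Policy) :
    ∃ π : M.Policy, h.IsLiftedPolicy πbar π := by
  choose π hπ using fun s => (πbar (h.f s)).exists_map_eq_of_surjective (h.measurable_g s)
    (h.surjective_g s)
  refine ⟨π, fun s β hβ => ?_⟩
  rw [← hπ s, Measure.map_apply (h.measurable_g s) hβ]
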